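/- Let $n \ge 2$ agents $N=\{1,\dots,n\}$ be the vertices of a finite simple connected undirected graph $G=(N,E)$, with neighbourhoods $N(i)$ and degrees $d(i)=|N(i)|$. Each agent $i$ has a kindness $k_i\in\mathbb{R}$, reciprocation coefficients $r_i, r_i'\in[0,1]$ with $r_i+r_i'\le 1$, and one of two reciprocation attitudes, fixed or floating. All agents act synchronously at the times $t=0,1,2,\dots$; for $(i,j)\in E$ the action $x_{i,j}(t)$ of $i$ on $j$ is given by $x_{i,j}(0)=k_i$ and, for $t\ge 1$, $$x_{i,j}(t)=(1-r_i-r_i')\,\kappa_{i,j}(t)+r_i\,x_{j,i}(t-1)+r_i'\,\frac{1}{d(i)}\sum_{l\in N(i)}x_{l,i}(t-1),$$ where $\kappa_{i,j}(t)=k_i$ if $i$ has the fixed attitude and $\kappa_{i,j}(t)=x_{i,j}(t-1)$ if $i$ has the floating attitude. When $r_i+r_i'=1$ the two attitudes coincide, and such an agent is counted as floating (and not as fixed). Theorem. Assume that $r_i'>0$ for all $i$, and that $G$ contains a cycle of odd length or at least one floating agent $i$ has $r_i+r_i'<1$. Then: 1. For every $(i,j)\in E$ the limit $L_{i,j}=\lim_{t\to\infty}x_{i,j}(t)$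 exists, and the convergence is geometrically fast: there is $\rho\in(0,1)$, depending only on the graph, the coefficients and the attitudes, such that for every kindness vector $k$ there is a constant $C$ with $|x_{i,j}(t)-L_{i,j}|\le C\rho^t$ for all $(i,j)\in E$ and all $t$. 2. There are coefficients $c_{i,j,m}$, not depending on the kindness values, such that $L_{i,j}=\sum_{m\in N}c_{i,j,m}k_m$ for every $(i,j)\in E$ and all kindness values. If at least one agent is fixed, then $c_{i,j,m}>0$ for every fixed agent $m$ and $c_{i,j,m}=0$ for every floating agent $m$. If all agents are floating, then $c_{i,j,m}>0$ for all $m\in N$ and $\sum_{m}c_{i,j,m}=1$. 3. If all agents are floating, then all the limits $L_{i,j}$ are equal to $$L=\frac{\sum_{i\in N}\frac{d(i)}{r_i+r_i'}\,k_i}{\sum_{i\in N}\frac{d(i)}{r_i+r_i'}}.$$ 4. If at least one agent is fixed and all fixed agents have the same kindness $k$, then $L_{i,j}=k$ for every $(i,j)\in E$. 5. If at least one agent is fixed, then changing only the kindness of the floating agents leaves all the limits $L_{i,j}$ unchanged. -/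

import Mathlib

open Filter Topology

/-- The reciprocation attitude of an agent. -/
inductive Attitude where
  | fixed : Attitude
  | floating : Attitude

/-- The behavioural parameters of the agents in `V`: reciprocation coefficients `r i`, `r' i`
in `[0, 1]` with `r i + r' i ≤ 1`, and a reciprocation attitude for each agent. -/
structure ReciprocalAgents (V : Type*) where
  r : V → ℝ
  r' : V → ℝ
  attitude : V → Attitude
  r_mem : ∀ i, r i ∈ Set.Icc (0 : ℝ) 1
  r'_mem : ∀ i, r' i ∈ Set.Icc (0 : ℝ) 1
  r_add_r'_le : ∀ i, r i + r' i ≤ 1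

namespace ReciprocalAgents

variable {V : Type*}

/-- Agent `i` counts as floating. If `r i + r' i = 1` the two attitudes prescribe the same
behaviour, and by convention such an agent is floating. -/
def IsFloating (P : ReciprocalAgents V) (i : V) : Prop :=
  P.attitude i = Attitude.floating ∨ P.r i + P.r' i = 1

/-- Agent `i` counts as fixed: she has the fixed attitude and `r i + r' i ≠ 1`. -/
def IsFixed (P : ReciprocalAgents V) (i : V) : Prop :=
  P.attitude i = Attitude.fixed ∧ P.r i + P.r' i ≠ 1

theorem not_isFixed_iff (P : ReciprocalAgents V) (i : V) : ¬ P.IsFixed i ↔ P.IsFloating i := by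
  unfold IsFixed IsFloating
  cases h : P.attitude i <;> simp

/-- The total contribution `got_i = ∑_{j ∈ N(i)} x_{j,i}` received by agent `i` from all her
neighbours, when the current actions are `x`. -/
def got [Fintype V] (G : SimpleGraph V) [DecidableRel G.Adj] (x : V → V → ℝ) (i : V) : ℝ :=
  ∑ j ∈ G.neighborFinset i, x j i

/-- The action `x_{i,j}(t)` of agent `i` on agent `j` at time `t`, when all agents act
synchronously (at every time `0, 1, 2, …`) and `k` is the vector of kindness values. It is
meaningful for adjacent `i`, `j`; the values at adjacent pairs depend only on earlier values at
adjacent pairs. -/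
noncomputable def action [Fintype V] (G : SimpleGraph V) [DecidableRel G.Adj]
    (P : ReciprocalAgents V) (k : V → ℝ) : ℕ → V → V → ℝ
  | 0, i, _ => k i
  | t + 1, i, j =>
    (1 - P.r i - P.r' i) *
        (match P.attitude i with
          | Attitude.fixed => k i
          | Attitude.floating => action G P k t i j)
      + P.r i * action G P k t j i
      + P.r' i * (got G (action G P k t) i / (G.degree i : ℝ))

end ReciprocalAgents

/-! Indexed by darts, the actions obey an affine recursion x(t+1) = A x(t) + b, with A nonnegative
and b linear in the kindness. A row of A sums to 1 minus the weight its agent keeps on kindness, so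
it is deficient exactly when that agent is fixed. Since r' > 0, a walk of length n yields positive
entries of A^(n+1); an odd cycle provides walks of every large length, and a floating agent with r +
r' < 1 provides a positive diagonal entry. Either way A is primitive (`exists_transition_pow_pos`).

With a fixed agent, some power of A has all row sums below 1, so A^t → 0 geometrically and x(t)
tends to (1 - A)⁻¹ b = ∑ A^t b. This depends on the fixed agents only, with positive coefficients,
which sum to 1 because A 1 = 1 - b(1).

With none, b = 0 and A is stochastic, with stationary law p(d) proportional to 1/(r + r') at the
start of d. Some power of A contracts the hyperplane p·x = 0 (Doeblin's argument), so x(t) tends to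
the constant p·x(0). Agent i starts d(i) darts, whence the weights d(i)/(r_i + r_i'). -/

namespace Matrix

/-! ### Nonnegative matrices: sup-norm bounds, positivity and row sums of powers -/

variable {D : Type*} [Fintype D]

theorem abs_mulVec_le_of_row_sum_le {B : Matrix D D ℝ} {q : ℝ} (hB : ∀ d e, 0 ≤ B d e)
    (hq : ∀ d, ∑ e, B d e ≤ q) (x : D → ℝ) (d : D) : |(B *ᵥ x) d| ≤ q * ‖x‖ := by
  calc |(B *ᵥ x) d| ≤ ∑ e, |B d e * x e| := Finset.abs_sum_le_sum_abs _ _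
    _ ≤ ∑ e, B d e * ‖x‖ := by
        refine Finset.sum_le_sum fun e _ => ?_
        rw [abs_mul, abs_of_nonneg (hB d e)]
        exact mul_le_mul_of_nonneg_left (norm_le_pi_norm x e) (hB d e)
    _ = (∑ e, B d e) * ‖x‖ := by rw [Finset.sum_mul]
    _ ≤ q * ‖x‖ := mul_le_mul_of_nonneg_right (hq d) (norm_nonneg x)

theorem norm_mulVec_le_of_row_sum_le {B : Matrix D D ℝ} {q : ℝ} (hB : ∀ d e, 0 ≤ B d e)
    (hq0 : 0 ≤ q) (hq : ∀ d, ∑ e, B d e ≤ q) (x : D → ℝ) : ‖B *ᵥ x‖ ≤ q * ‖x‖ :=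
  (pi_norm_le_iff_of_nonneg (by positivity)).2 (abs_mulVec_le_of_row_sum_le hB hq x)

theorem mulVec_nonneg_of_nonneg {B : Matrix D D ℝ} (hB : ∀ d e, 0 ≤ B d e) {x : D → ℝ}
    (hx : ∀ e, 0 ≤ x e) (d : D) : 0 ≤ (B *ᵥ x) d :=
  Finset.sum_nonneg fun e _ => mul_nonneg (hB d e) (hx e)

variable [DecidableEq D]

theorem pow_entry_nonneg {A : Matrix D D ℝ} (hA : ∀ d e, 0 ≤ A d e) (n : ℕ) :
    ∀ d e, 0 ≤ (A ^ n) d e := by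
  induction n with
  | zero => intro d e; rw [pow_zero, one_apply]; split_ifs <;> norm_num
  | succ n ih =>
    intro d e
    rw [pow_succ, mul_apply]
    exact Finset.sum_nonneg fun f _ => mul_nonneg (ih d f) (hA f e)

theorem pow_add_entry_pos {A : Matrix D D ℝ} (hA : ∀ d e, 0 ≤ A d e) {m n : ℕ} {d e f : D}
    (h₁ : 0 < (A ^ m) d e) (h₂ : 0 < (A ^ n) e f) : 0 < (A ^ (m + n)) d f := by
  rw [pow_add, mul_apply]
  exact Finset.sum_pos' (fun g _ => mul_nonneg (pow_entry_nonneg hA m d g)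
    (pow_entry_nonneg hA n g f)) ⟨e, Finset.mem_univ e, mul_pos h₁ h₂⟩

theorem pow_diag_pos {A : Matrix D D ℝ} (hA : ∀ d e, 0 ≤ A d e) {d : D} (hd : 0 < A d d)
    (n : ℕ) : 0 < (A ^ n) d d := by
  induction n with
  | zero => simp
  | succ n ih => exact pow_add_entry_pos hA ih (by rwa [pow_one])

/-- An irreducible nonnegative matrix with a positive diagonal entry is primitive. -/
theorem eventually_pow_pos_of_diag_pos {A : Matrix D D ℝ} (hA : ∀ d e, 0 ≤ A d e)
    (hirr : ∀ d e, ∃ n, 0 < (A ^ n) d e) {d₀ : D} (hd₀ : 0 < A d₀ d₀) (d e : D) :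
    ∀ᶠ n in atTop, 0 < (A ^ n) d e := by
  obtain ⟨p, hp⟩ := hirr d d₀
  obtain ⟨q, hq⟩ := hirr d₀ e
  -- Surplus length is spent looping at `d₀`.
  filter_upwards [eventually_ge_atTop (p + q)] with n hn
  obtain ⟨k, rfl⟩ := Nat.exists_eq_add_of_le hn
  have := pow_add_entry_pos hA (pow_add_entry_pos hA hp (pow_diag_pos hA hd₀ k)) hq
  rwa [show p + q + k = p + k + q by ring]

theorem pow_row_sum_le_one {A : Matrix D D ℝ} (hA : ∀ d e, 0 ≤ A d e)
    (hrow : ∀ d, ∑ e, A d e ≤ 1) (n : ℕ) : ∀ d, ∑ e, (A ^ n) d e ≤ 1 := by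
  induction n with
  | zero => intro d; simp [one_apply]
  | succ n ih =>
    intro d
    simp only [pow_succ, mul_apply]
    rw [Finset.sum_comm]
    simp only [← Finset.mul_sum]
    exact (Finset.sum_le_sum fun f _ =>
      mul_le_of_le_one_right (pow_entry_nonneg hA n d f) (hrow f)).trans (ih d)

/-- Row `d` of the power `N + 1` sums the row sums of `A` with the weights `(A ^ N) d f`; the
deficient row `d₀` enters with positive weight. -/
theorem pow_succ_row_sum_lt_one {A : Matrix D D ℝ} (hA : ∀ d e, 0 ≤ A d e)
    (hrow : ∀ d, ∑ e, A d e ≤ 1) {d₀ : D} (hd₀ : ∑ e, A d₀ e < 1) {N : ℕ}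
    {d : D} (hN : 0 < (A ^ N) d d₀) : ∑ e, (A ^ (N + 1)) d e < 1 := by
  simp only [pow_succ, mul_apply]
  rw [Finset.sum_comm]
  simp only [← Finset.mul_sum]
  refine lt_of_lt_of_le (Finset.sum_lt_sum (fun f _ =>
      mul_le_of_le_one_right (pow_entry_nonneg hA N d f) (hrow f))
      ⟨d₀, Finset.mem_univ d₀, mul_lt_of_lt_one_right hN hd₀⟩) (pow_row_sum_le_one hA hrow N d)

end Matrix

/-- A nonincreasing sequence that contracts every `N` steps decays geometrically. -/
theorem exists_geometric_rate {N : ℕ} (hN : 0 < N) {q : ℝ} (hq0 : 0 < q) (hq1 : q < 1) :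
    ∃ ρ C : ℝ, 0 < ρ ∧ ρ < 1 ∧ 0 ≤ C ∧ ∀ u : ℕ → ℝ, (∀ t, 0 ≤ u t) → (∀ t, u (t + 1) ≤ u t) →
      (∀ t, u (t + N) ≤ q * u t) → ∀ t, u t ≤ C * ρ ^ t * u 0 := by
  have hN' : (N : ℝ) ≠ 0 := by exact_mod_cast hN.ne'
  set ρ := q ^ (1 / (N : ℝ)) with hρ
  have hρ0 : 0 < ρ := Real.rpow_pos_of_pos hq0 _
  have hρ1 : ρ < 1 := Real.rpow_lt_one hq0.le hq1 (by positivity)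
  have hρN : ρ ^ N = q := by
    rw [hρ, ← Real.rpow_natCast, ← Real.rpow_mul hq0.le, one_div, inv_mul_cancel₀ hN',
      Real.rpow_one]
  refine ⟨ρ, q⁻¹, hρ0, hρ1, by positivity, fun u hu0 hu hc => ?_⟩
  -- The constant `q⁻¹` pays for an incomplete block: if `t < N`, then `q = ρ ^ N ≤ ρ ^ t`.
  have key : ∀ t, q * u t ≤ ρ ^ t * u 0 := by
    intro t
    induction t using Nat.strong_induction_on with
    | _ t ih =>
      rcases lt_or_ge t N with ht | ht
      · rw [← hρN]
        exact mul_le_mul (pow_le_pow_of_le_one hρ0.le hρ1.le ht.le)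
          (antitone_nat_of_succ_le hu (Nat.zero_le t)) (hu0 t) (by positivity)
      · obtain ⟨s, rfl⟩ := Nat.exists_eq_add_of_le' ht
        calc q * u (s + N) ≤ q * (q * u s) := mul_le_mul_of_nonneg_left (hc s) hq0.le
          _ ≤ q * (ρ ^ s * u 0) := mul_le_mul_of_nonneg_left (ih s (by omega)) hq0.le
          _ = ρ ^ (s + N) * u 0 := by rw [pow_add, hρN]; ring
  intro t
  rw [mul_assoc, ← div_eq_inv_mul, le_div_iff₀ hq0, mul_comm]
  exact key t

/-! ### Geometric decay for primitive substochastic and stochastic matrices -/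

namespace Matrix

variable {D : Type*} [Fintype D] [DecidableEq D] [Nonempty D]

/-- The powers of a primitive substochastic matrix with a deficient row decay geometrically. -/
theorem exists_rate_of_substochastic {A : Matrix D D ℝ} (hA : ∀ d e, 0 ≤ A d e)
    (hrow : ∀ d, ∑ e, A d e ≤ 1) {d₀ : D} (hd₀ : ∑ e, A d₀ e < 1) {N : ℕ}
    (hN : ∀ d e, 0 < (A ^ N) d e) :
    ∃ ρ C : ℝ, 0 < ρ ∧ ρ < 1 ∧ 0 ≤ C ∧ ∀ (x : D → ℝ) t, ‖(A ^ t) *ᵥ x‖ ≤ C * ρ ^ t * ‖x‖ := by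
  obtain ⟨q, hq, hq1⟩ : ∃ q, (∀ d, ∑ e, (A ^ (N + 1)) d e ≤ q) ∧ q < 1 := by
    obtain ⟨d, hd⟩ := Finite.exists_max fun d => ∑ e, (A ^ (N + 1)) d e
    exact ⟨_, hd, pow_succ_row_sum_lt_one hA hrow hd₀ (hN d d₀)⟩
  -- The maximum with 1/2 makes the contraction factor strictly positive.
  obtain ⟨ρ, C, hρ0, hρ1, hC, h⟩ :=
    exists_geometric_rate N.succ_pos (lt_max_of_lt_right (b := q) one_half_pos)
      (max_lt hq1 one_half_lt_one)
  refine ⟨ρ, C, hρ0, hρ1, hC, fun x t => ?_⟩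
  have := h (fun t => ‖(A ^ t) *ᵥ x‖) (fun t => norm_nonneg _) (fun t => ?_) (fun t => ?_) t
  · simpa using this
  · rw [pow_succ', ← mulVec_mulVec]
    simpa using norm_mulVec_le_of_row_sum_le hA zero_le_one hrow ((A ^ t) *ᵥ x)
  · rw [add_comm, pow_add, ← mulVec_mulVec]
    exact norm_mulVec_le_of_row_sum_le (pow_entry_nonneg hA _) (by positivity)
      (fun d => (hq d).trans (le_max_left _ _)) _

/-- The powers of a primitive stochastic matrix converge geometrically to the projection given by
a stationary distribution. -/
theorem exists_rate_of_stochastic {A : Matrix D D ℝ} (hA : ∀ d e, 0 ≤ A d e)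
    (hrow : ∀ d, ∑ e, A d e = 1) {p : D → ℝ} (hp0 : ∀ d, 0 ≤ p d) (hp1 : ∑ d, p d = 1)
    (hpA : p ᵥ* A = p) {N : ℕ} (hN0 : 0 < N)
    (hN : ∀ d e, 0 < (A ^ N) d e) :
    ∃ ρ C : ℝ, 0 < ρ ∧ ρ < 1 ∧ 0 ≤ C ∧ ∀ (x : D → ℝ), p ⬝ᵥ x = 0 → ∀ t,
      ‖(A ^ t) *ᵥ x‖ ≤ C * ρ ^ t * ‖x‖ := by
  have hrow' : ∀ d, ∑ e, A d e ≤ 1 := fun d => (hrow d).le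
  have hone : A *ᵥ 1 = 1 := by ext d; simpa [mulVec, dotProduct] using hrow d
  have hpow : ∀ n, (A ^ n) *ᵥ (1 : D → ℝ) = 1 := by
    intro n
    induction n with
    | zero => simp
    | succ n ih => rw [pow_succ, ← mulVec_mulVec, hone, ih]
  obtain ⟨δ, hδ0, hδ1, hδ⟩ : ∃ δ : ℝ, 0 < δ ∧ δ < 1 ∧ ∀ d e, δ ≤ (A ^ N) d e := by
    obtain ⟨a, ha⟩ := Finite.exists_min fun a : D × D => (A ^ N) a.1 a.2
    -- The cap 1/2 keeps `1 - δ` positive even if the least entry is 1.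
    refine ⟨min ((A ^ N) a.1 a.2) (1 / 2), lt_min (hN _ _) one_half_pos,
      (min_le_right _ _).trans_lt one_half_lt_one, fun d e => (min_le_left _ _).trans (ha (d, e))⟩
  have hp_le : ∀ e, p e ≤ 1 := fun e =>
    hp1 ▸ Finset.single_le_sum (fun d _ => hp0 d) (Finset.mem_univ e)
  obtain ⟨ρ, C, hρ0, hρ1, hC, h⟩ := exists_geometric_rate hN0 (sub_pos.2 hδ1) (sub_lt_self 1 hδ0)
  refine ⟨ρ, C, hρ0, hρ1, hC, fun x hx t => ?_⟩
  have hinv : ∀ t, p ⬝ᵥ ((A ^ t) *ᵥ x) = 0 := by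
    intro t
    induction t with
    | zero => simpa using hx
    | succ t ih => rw [pow_succ', ← mulVec_mulVec, dotProduct_mulVec, hpA, ih]
  have := h (fun t => ‖(A ^ t) *ᵥ x‖) (fun t => norm_nonneg _) (fun t => ?_) (fun t => ?_) t
  · simpa using this
  · rw [pow_succ', ← mulVec_mulVec]
    simpa using norm_mulVec_le_of_row_sum_le hA zero_le_one hrow' ((A ^ t) *ᵥ x)
  · rw [add_comm, pow_add, ← mulVec_mulVec]
    -- Doeblin's trick: on vectors orthogonal to `p`, subtracting the rank-one matrix with rows `δ *
    -- p` changes nothing, yet leaves a nonnegative matrix with row sums `1 - δ`.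
    have hB : (A ^ N) *ᵥ ((A ^ t) *ᵥ x)
        = (A ^ N - of fun _ e => δ * p e) *ᵥ ((A ^ t) *ᵥ x) := by
      rw [sub_mulVec, eq_comm, sub_eq_self]
      ext d
      have := congrArg (δ * ·) (hinv t)
      simpa [mulVec, dotProduct, Finset.mul_sum, mul_assoc] using this
    rw [hB]
    refine norm_mulVec_le_of_row_sum_le (fun d e => ?_) (sub_pos.2 hδ1).le (fun d => ?_) _
    · simp only [sub_apply, of_apply, sub_nonneg]
      exact (mul_le_of_le_one_right hδ0.le (hp_le e)).trans (hδ d e)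
    · have := congrFun (hpow N) d
      simp only [mulVec, dotProduct, Pi.one_apply, mul_one] at this
      simp [Finset.sum_sub_distrib, ← Finset.mul_sum, hp1, this]

end Matrix

/-! ### Walks of prescribed length and sums over darts -/

namespace SimpleGraph

variable {V : Type*} {G : SimpleGraph V}

theorem Walk.exists_length_add_two_mul {u v w : V} (p : G.Walk u v) (hw : G.Adj v w) (s : ℕ) :
    ∃ q : G.Walk u v, q.length = p.length + 2 * s := by
  induction s with
  | zero => exact ⟨p, by simp⟩
  | succ s ih =>
    obtain ⟨q, hq⟩ := ih
    exact ⟨(q.concat hw).concat hw.symm, by simp [hq]; ring⟩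

/-- In a connected graph with an odd closed walk, any two vertices are joined by walks of all
sufficiently large lengths. -/
theorem Connected.eventually_exists_walk_length_eq [Nontrivial V] (hG : G.Connected) {a : V}
    (c : G.Walk a a) (hc : Odd c.length) (u v : V) :
    ∀ᶠ n in atTop, ∃ p : G.Walk u v, p.length = n := by
  obtain ⟨p⟩ := hG.preconnected u a
  obtain ⟨q⟩ := hG.preconnected a v
  obtain ⟨w, hw⟩ := hG.preconnected.exists_adj_of_nontrivial v
  filter_upwards [eventually_ge_atTop (p.length + c.length + q.length)] with n hn
  obtain ⟨m, hm⟩ := hc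
  -- A detour through `c` corrects the parity; steps back and forth along an edge at `v` fill the
  -- rest.
  rcases Nat.even_or_odd' (n - (p.length + q.length)) with ⟨s, hs | hs⟩
  · obtain ⟨x, hx⟩ := (p.append q).exists_length_add_two_mul hw s
    exact ⟨x, by rw [hx, Walk.length_append]; omega⟩
  · obtain ⟨x, hx⟩ := ((p.append c).append q).exists_length_add_two_mul hw (s - m)
    exact ⟨x, by rw [hx, Walk.length_append, Walk.length_append]; omega⟩

variable [Fintype V] [DecidableRel G.Adj]

theorem sum_dart_snd_eq (f : V → V → ℝ) (i : V) [DecidableEq V] :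
    ∑ e : G.Dart, (if e.snd = i then f e.fst e.snd else 0) = ∑ j ∈ G.neighborFinset i, f j i := by
  rw [← Finset.sum_filter]
  refine Finset.sum_bij' (fun e _ => e.fst)
    (fun j hj => ⟨(j, i), ((G.mem_neighborFinset i j).1 hj).symm⟩) ?_ ?_ ?_ ?_ ?_
  · intro e he
    obtain rfl := (Finset.mem_filter.1 he).2
    exact (G.mem_neighborFinset _ _).2 e.adj.symm
  · intro j hj; simp
  · intro e he
    obtain rfl := (Finset.mem_filter.1 he).2
    rfl
  · intro j hj; rfl
  · intro e he
    obtain rfl := (Finset.mem_filter.1 he).2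
    rfl

theorem sum_dart_fst_ite_eq (g : V → ℝ) (i : V) [DecidableEq V] :
    ∑ d : G.Dart, (if d.fst = i then g d.fst else 0) = G.degree i * g i := by
  rw [← Finset.sum_filter, Finset.sum_congr rfl (g := fun _ => g i), Finset.sum_const,
    G.dart_fst_fiber_card_eq_degree, nsmul_eq_mul]
  intro d hd
  rw [(Finset.mem_filter.1 hd).2]

theorem sum_dart_fst_eq (g : V → ℝ) :
    ∑ d : G.Dart, g d.fst = ∑ i, (G.degree i : ℝ) * g i := by
  classical
  simp only [← sum_dart_fst_ite_eq]
  rw [Finset.sum_comm]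
  simp

theorem Dart.degree_fst_pos (d : G.Dart) : (0 : ℝ) < G.degree d.fst := by
  exact_mod_cast (G.degree_pos_iff_exists_adj _).2 ⟨_, d.adj⟩

end SimpleGraph

/-! ### The transition matrix on darts and its primitivity -/

namespace ReciprocalAgents

variable {V : Type*} (P : ReciprocalAgents V)

/-- The weight that agent `i` gives to her own previous action. -/
def inertia (i : V) : ℝ :=
  match P.attitude i with
  | Attitude.fixed => 0
  | Attitude.floating => 1 - P.r i - P.r' i

/-- The weight that agent `i` gives to her kindness at positive times. -/
def stubbornness (i : V) : ℝ :=
  match P.attitude i with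
  | Attitude.fixed => 1 - P.r i - P.r' i
  | Attitude.floating => 0

theorem inertia_add_stubbornness (i : V) :
    P.inertia i + P.stubbornness i = 1 - P.r i - P.r' i := by
  unfold inertia stubbornness
  cases P.attitude i <;> simp

theorem inertia_nonneg (i : V) : 0 ≤ P.inertia i := by
  have := P.r_add_r'_le i
  unfold inertia
  cases P.attitude i <;> simp only [] <;> linarith

theorem stubbornness_nonneg (i : V) : 0 ≤ P.stubbornness i := by
  have := P.r_add_r'_le i
  unfold stubbornness
  cases P.attitude i <;> simp only [] <;> linarith

theorem inertia_pos {i : V} (hi : P.IsFloating i) (hlt : P.r i + P.r' i < 1) :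
    0 < P.inertia i := by
  have : P.attitude i = Attitude.floating := hi.resolve_right hlt.ne
  simp only [inertia, this]
  linarith

theorem stubbornness_pos {i : V} (hi : P.IsFixed i) : 0 < P.stubbornness i := by
  have := lt_of_le_of_ne (P.r_add_r'_le i) hi.2
  simp only [stubbornness, hi.1]
  linarith

theorem stubbornness_eq_zero {i : V} (hi : P.IsFloating i) : P.stubbornness i = 0 := by
  unfold stubbornness
  rcases hi with h | h
  · simp [h]
  · cases P.attitude i <;> simp
    linarith

variable [Fintype V] (G : SimpleGraph V) [DecidableRel G.Adj]

open scoped Classical in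
/-- The matrix that gives the actions at one time in terms of those at the previous time. -/
noncomputable def transition : Matrix G.Dart G.Dart ℝ := fun d e =>
  (if e = d then P.inertia d.fst else 0) + (if e = d.symm then P.r d.fst else 0)
    + (if e.snd = d.fst then P.r' d.fst / G.degree d.fst else 0)

/-- The direct contribution of the kindness values to the actions at positive times. -/
def kindnessInput (k : V → ℝ) : G.Dart → ℝ := fun d => P.stubbornness d.fst * k d.fst

/-- The actions at time `t` as a vector indexed by the darts. -/
noncomputable def dartAction (k : V → ℝ) (t : ℕ) : G.Dart → ℝ :=
  fun d => P.action G k t d.fst d.snd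

theorem transition_nonneg (d e : G.Dart) : 0 ≤ P.transition G d e := by
  have h₁ := P.inertia_nonneg d.fst
  have h₂ := (P.r_mem d.fst).1
  have h₃ := (P.r'_mem d.fst).1
  unfold transition
  positivity

theorem transition_diag_pos {d : G.Dart} (hd : P.IsFloating d.fst)
    (hlt : P.r d.fst + P.r' d.fst < 1) : 0 < P.transition G d d := by
  have h₁ := P.inertia_pos hd hlt
  have h₂ := (P.r_mem d.fst).1
  have h₃ := (P.r'_mem d.fst).1
  unfold transition
  rw [if_pos rfl]
  positivity

theorem transition_pos_of_snd_eq {d e : G.Dart} (hr' : 0 < P.r' d.fst) (h : e.snd = d.fst) :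
    0 < P.transition G d e := by
  have h₁ := P.inertia_nonneg d.fst
  have h₂ := (P.r_mem d.fst).1
  have h₃ := d.degree_fst_pos
  unfold transition
  rw [if_pos h]
  positivity

theorem transition_mulVec (y : V → V → ℝ) (d : G.Dart) :
    (P.transition G).mulVec (fun e => y e.fst e.snd) d
      = P.inertia d.fst * y d.fst d.snd + P.r d.fst * y d.snd d.fst
        + P.r' d.fst * (got G y d.fst / G.degree d.fst) := by
  classical
  simp only [Matrix.mulVec, dotProduct, transition, add_mul, Finset.sum_add_distrib, ite_mul,
    zero_mul, Finset.sum_ite_eq', Finset.mem_univ, if_true, got]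
  congr 1
  rw [SimpleGraph.sum_dart_snd_eq (fun a b => P.r' d.fst / G.degree d.fst * y a b) d.fst,
    ← Finset.mul_sum]
  ring

theorem transition_row_sum (d : G.Dart) :
    ∑ e, P.transition G d e = 1 - P.stubbornness d.fst := by
  have h := P.transition_mulVec G (fun _ _ => 1) d
  have hd := d.degree_fst_pos.ne'
  have := P.inertia_add_stubbornness d.fst
  simp only [Matrix.mulVec, dotProduct, mul_one, got, Finset.sum_const, nsmul_eq_mul,
    SimpleGraph.card_neighborFinset_eq_degree, div_self hd] at h
  linarith

theorem dartAction_succ (k : V → ℝ) (t : ℕ) :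
    P.dartAction G k (t + 1)
      = (P.transition G).mulVec (P.dartAction G k t) + P.kindnessInput G k := by
  ext d
  have := P.transition_mulVec G (P.action G k t) d
  unfold dartAction
  rw [Pi.add_apply, this, action, kindnessInput, inertia, stubbornness]
  cases P.attitude d.fst <;> simp only <;> ring

/-- Used to find the stationary law: if all inertias are `1 - r - r'`, then `w` is invariant as soon
as `w * (r + r')` is constant. -/
theorem vecMul_transition (w : V → ℝ) (e : G.Dart) :
    Matrix.vecMul (fun d : G.Dart => w d.fst) (P.transition G) e
      = w e.fst * P.inertia e.fst + w e.snd * (P.r e.snd + P.r' e.snd) := by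
  classical
  have hs : ∀ d : G.Dart, e = d.symm ↔ d = e.symm := fun d =>
    ⟨fun h => by rw [h, SimpleGraph.Dart.symm_symm], fun h => by
      rw [h, SimpleGraph.Dart.symm_symm]⟩
  have hd := e.symm.degree_fst_pos.ne'
  simp only [Matrix.vecMul, dotProduct, transition, mul_add, Finset.sum_add_distrib, mul_ite,
    mul_zero, hs, Finset.sum_ite_eq', Finset.sum_ite_eq, Finset.mem_univ, if_true,
    eq_comm (a := e.snd)]
  rw [SimpleGraph.sum_dart_fst_ite_eq (fun i => w i * (P.r' i / G.degree i)) e.snd]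
  change (G.degree e.snd : ℝ) ≠ 0 at hd
  change w e.fst * P.inertia e.fst + w e.snd * P.r e.snd + _ = _
  field_simp
  ring

open scoped Classical in
-- Influence runs backwards: a dart reacts to every dart ending at its source. A walk from `d.fst`
-- to `e.snd` thus gives a chain of such reactions, the last one, onto `e`, costing the extra step.
theorem transition_pow_pos_of_walk (hr' : ∀ i, 0 < P.r' i) {u v : V} (p : G.Walk u v) :
    ∀ d e : G.Dart, d.fst = u → e.snd = v → 0 < (P.transition G ^ (p.length + 1)) d e := by
  induction p with
  | nil =>
    intro d e hd he
    simpa using P.transition_pos_of_snd_eq G (hr' _) (he.trans hd.symm)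
  | @cons u v w huv p ih =>
    intro d e hd he
    have h₁ := P.transition_pos_of_snd_eq G (e := ⟨(v, u), huv.symm⟩) (hr' d.fst) hd.symm
    have h₂ := ih ⟨(v, u), huv.symm⟩ e rfl he
    have := Matrix.pow_add_entry_pos (P.transition_nonneg G) (m := 1) (by rwa [pow_one]) h₂
    rwa [add_comm] at this

open scoped Classical in
/-- The transition matrix is primitive. -/
theorem exists_transition_pow_pos [Nontrivial V] (hG : G.Connected) (hr' : ∀ i, 0 < P.r' i)
    (h : (∃ (v : V) (c : G.Walk v v), c.IsCycle ∧ Odd c.length) ∨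
      (∃ i, P.IsFloating i ∧ P.r i + P.r' i < 1)) :
    ∃ N, 0 < N ∧ ∀ d e, 0 < (P.transition G ^ N) d e := by
  suffices ∀ᶠ n in atTop, ∀ d e, 0 < (P.transition G ^ n) d e from
    ((eventually_gt_atTop 0).and this).exists
  refine eventually_all.2 fun d => eventually_all.2 fun e => ?_
  rcases h with ⟨a, c, -, hc⟩ | ⟨i, hi, hlt⟩
  · have := hG.eventually_exists_walk_length_eq c hc d.fst e.snd
    -- Shift by one, since walks of length `n` control the power `n + 1`.
    rw [← map_add_atTop_eq_nat 1, eventually_map]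
    exact this.mono fun n ⟨p, hp⟩ => hp ▸ P.transition_pow_pos_of_walk G hr' p d e rfl rfl
  · obtain ⟨j, hij⟩ := hG.preconnected.exists_adj_of_nontrivial i
    refine Matrix.eventually_pow_pos_of_diag_pos (P.transition_nonneg G) (fun d e => ?_)
      (P.transition_diag_pos G (d := ⟨(i, j), hij⟩) hi hlt) d e
    obtain ⟨p⟩ := hG.preconnected d.fst e.snd
    exact ⟨_, P.transition_pow_pos_of_walk G hr' p d e rfl rfl⟩

end ReciprocalAgents

/-! ### Limits and rates, without and with fixed agents -/

namespace ReciprocalAgents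

variable {V : Type*} [Fintype V] (P : ReciprocalAgents V) (G : SimpleGraph V) [DecidableRel G.Adj]

theorem transition_row_sum_le_one (d : G.Dart) : ∑ e, P.transition G d e ≤ 1 := by
  rw [transition_row_sum]
  linarith [P.stubbornness_nonneg d.fst]

theorem transition_mulVec_one :
    (P.transition G).mulVec 1 = 1 - P.kindnessInput G 1 := by
  ext d
  simpa [Matrix.mulVec, dotProduct, kindnessInput] using P.transition_row_sum G d

open scoped Classical in
-- Subtracting an equilibrium turns the affine recursion into a linear one.
theorem dartAction_sub_of_eq {k : V → ℝ} {z : G.Dart → ℝ}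
    (hz : z = (P.transition G).mulVec z + P.kindnessInput G k) (t : ℕ) :
    P.dartAction G k t - z = (P.transition G ^ t).mulVec (P.dartAction G k 0 - z) := by
  induction t with
  | zero => simp
  | succ t ih =>
    rw [pow_succ', ← Matrix.mulVec_mulVec, ← ih, Matrix.mulVec_sub, dartAction_succ]
    nth_rw 1 [hz]
    abel

/-- If all agents are floating, then the actions converge geometrically to the mean of the
kindness values weighted by `d(i) / (r i + r' i)`. -/
theorem exists_rate_of_forall_isFloating [Nontrivial V] (hG : G.Connected)
    (hr' : ∀ i, 0 < P.r' i)
    (h : (∃ (v : V) (c : G.Walk v v), c.IsCycle ∧ Odd c.length) ∨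
      (∃ i, P.IsFloating i ∧ P.r i + P.r' i < 1)) (hfl : ∀ m, P.IsFloating m) :
    ∃ ρ : ℝ, 0 < ρ ∧ ρ < 1 ∧ ∀ k : V → ℝ, ∃ C : ℝ, ∀ d t,
      |P.dartAction G k t d - (∑ m, (G.degree m : ℝ) / (P.r m + P.r' m) * k m) /
          (∑ m, (G.degree m : ℝ) / (P.r m + P.r' m))| ≤ C * ρ ^ t := by
  classical
  obtain ⟨N, hN0, hN⟩ := P.exists_transition_pow_pos G hG hr' h
  have hne : Nonempty G.Dart := by
    obtain ⟨v⟩ := hG.nonempty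
    obtain ⟨w, hw⟩ := hG.preconnected.exists_adj_of_nontrivial v
    exact ⟨⟨(v, w), hw⟩⟩
  have hs : ∀ i, 0 < P.r i + P.r' i := fun i => add_pos_of_nonneg_of_pos (P.r_mem i).1 (hr' i)
  have hst : ∀ i, P.stubbornness i = 0 := fun i => P.stubbornness_eq_zero (hfl i)
  set W := ∑ m, (G.degree m : ℝ) / (P.r m + P.r' m) with hW
  have hWsum : ∀ k : V → ℝ, ∑ d : G.Dart, 1 / (P.r d.fst + P.r' d.fst) * k d.fst
      = ∑ m, (G.degree m : ℝ) / (P.r m + P.r' m) * k m := fun k => by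
    rw [SimpleGraph.sum_dart_fst_eq (G := G) (fun i => 1 / (P.r i + P.r' i) * k i)]
    exact Finset.sum_congr rfl fun i _ => by ring
  have hWd : ∑ d : G.Dart, 1 / (P.r d.fst + P.r' d.fst) = W := by
    simpa using hWsum 1
  have hW0 : 0 < W := by
    rw [← hWd]
    exact Finset.sum_pos (fun d _ => one_div_pos.2 (hs d.fst)) Finset.univ_nonempty
  let p : G.Dart → ℝ := fun d => (1 / (P.r d.fst + P.r' d.fst)) / W
  have hp1 : ∑ d, p d = 1 := by
    rw [← Finset.sum_div, hWd, div_self hW0.ne']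
  have hpA : Matrix.vecMul p (P.transition G) = p := by
    ext e
    have hi := P.inertia_add_stubbornness e.fst
    rw [hst, add_zero] at hi
    have h₁ := (hs e.fst).ne'
    have h₂ := (hs e.snd).ne'
    rw [P.vecMul_transition G (fun i => (1 / (P.r i + P.r' i)) / W) e, hi]
    simp only [p]
    field_simp
    ring
  obtain ⟨ρ, C, hρ0, hρ1, -, hrate⟩ := Matrix.exists_rate_of_stochastic (P.transition_nonneg G)
    (fun d => by rw [transition_row_sum, hst, sub_zero])
    (fun d => (div_pos (one_div_pos.2 (hs d.fst)) hW0).le) hp1 hpA hN0 hN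
  refine ⟨ρ, hρ0, hρ1, fun k => ?_⟩
  set ℓ := (∑ m, (G.degree m : ℝ) / (P.r m + P.r' m) * k m) / W with hℓ
  have hin : ∀ k, P.kindnessInput G k = 0 := fun k => by ext d; simp [kindnessInput, hst]
  have hz : (ℓ • 1 : G.Dart → ℝ)
      = (P.transition G).mulVec (ℓ • 1) + P.kindnessInput G k := by
    rw [Matrix.mulVec_smul, transition_mulVec_one, hin, hin, sub_zero, add_zero]
  -- The `p`-mean of the initial actions is `ℓ`, as each agent plays her kindness on all her darts.
  have horth : p ⬝ᵥ (P.dartAction G k 0 - ℓ • 1) = 0 := by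
    rw [dotProduct_sub, dotProduct_smul, dotProduct_one, hp1, smul_eq_mul, mul_one, hℓ, ← hWsum,
      Finset.sum_div, sub_eq_zero]
    exact Finset.sum_congr rfl fun d _ => by simp only [p, dartAction, action]; ring
  refine ⟨C * ‖P.dartAction G k 0 - ℓ • 1‖, fun d t => ?_⟩
  have h₁ := hrate _ horth t
  rw [← P.dartAction_sub_of_eq G hz] at h₁
  have h₂ := (norm_le_pi_norm _ d).trans h₁
  rw [Real.norm_eq_abs, mul_right_comm] at h₂
  simpa using h₂

/-- If some agent is fixed, then the actions converge geometrically to weighted means of the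
kindness values of the fixed agents, with positive weights. -/
theorem exists_rate_of_exists_isFixed [Nontrivial V] (hG : G.Connected)
    (hr' : ∀ i, 0 < P.r' i)
    (h : (∃ (v : V) (c : G.Walk v v), c.IsCycle ∧ Odd c.length) ∨
      (∃ i, P.IsFloating i ∧ P.r i + P.r' i < 1)) (hfix : ∃ m, P.IsFixed m) :
    ∃ (c : G.Dart → V → ℝ) (ρ : ℝ), 0 < ρ ∧ ρ < 1 ∧
      (∀ k : V → ℝ, ∃ C : ℝ, ∀ d t, |P.dartAction G k t d - ∑ m, c d m * k m| ≤ C * ρ ^ t) ∧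
      (∀ d m, P.IsFixed m → 0 < c d m) ∧ (∀ d m, P.IsFloating m → c d m = 0) ∧
      ∀ d, ∑ m, c d m = 1 := by
  classical
  obtain ⟨N, hN0, hN⟩ := P.exists_transition_pow_pos G hG hr' h
  have hdart : ∀ v, ∃ d : G.Dart, d.fst = v := fun v =>
    have ⟨w, hw⟩ := hG.preconnected.exists_adj_of_nontrivial v
    ⟨⟨(v, w), hw⟩, rfl⟩
  have hne : Nonempty G.Dart := ⟨(hdart hG.nonempty.some).choose⟩
  set A := P.transition G with hA
  obtain ⟨ρ, C, hρ0, hρ1, hC, hrate⟩ : ∃ ρ C : ℝ, 0 < ρ ∧ ρ < 1 ∧ 0 ≤ C ∧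
      ∀ (x : G.Dart → ℝ) t, ‖(A ^ t).mulVec x‖ ≤ C * ρ ^ t * ‖x‖ := by
    obtain ⟨m, hm⟩ := hfix
    obtain ⟨d₀, rfl⟩ := hdart m
    refine Matrix.exists_rate_of_substochastic (P.transition_nonneg G)
      (P.transition_row_sum_le_one G) (d₀ := d₀) ?_ hN
    rw [transition_row_sum]
    linarith [P.stubbornness_pos hm]
  have hlim : ∀ (x : G.Dart → ℝ), Tendsto (fun t => (A ^ t).mulVec x) atTop (𝓝 0) := fun x => by
    refine squeeze_zero_norm (hrate x) ?_
    simpa using ((tendsto_pow_atTop_nhds_zero_of_lt_one hρ0.le hρ1).const_mul C).mul_const ‖x‖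
  -- A kernel vector of `1 - A` is fixed by every `A ^ t`, while `A ^ t` tends to 0.
  have hunit : IsUnit (1 - A) := by
    rw [← Matrix.mulVec_injective_iff_isUnit]
    refine (injective_iff_map_eq_zero (Matrix.mulVecLin (1 - A))).2 fun x hx => ?_
    rw [Matrix.mulVecLin_apply, Matrix.sub_mulVec, Matrix.one_mulVec, sub_eq_zero] at hx
    have : ∀ t, (A ^ t).mulVec x = x := by
      intro t
      induction t with
      | zero => simp
      | succ t ih => rw [pow_succ, ← Matrix.mulVec_mulVec, ← hx, ih]
    have hx0 := hlim x
    simp only [this] at hx0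
    exact tendsto_nhds_unique tendsto_const_nhds hx0
  have hdet : IsUnit (1 - A).det := (Matrix.isUnit_iff_isUnit_det _).1 hunit
  let v : V → G.Dart → ℝ := fun m => P.kindnessInput G (Pi.single m 1)
  -- The equilibrium for kindness 1 at `m` and 0 elsewhere; by linearity its entries are the
  -- coefficients of `k m`.
  let z : V → G.Dart → ℝ := fun m => ((1 - A)⁻¹).mulVec (v m)
  have hz : ∀ m, z m = A.mulVec (z m) + v m := fun m => by
    have : (1 - A).mulVec (z m) = v m := by
      rw [Matrix.mulVec_mulVec, Matrix.mul_nonsing_inv _ hdet, Matrix.one_mulVec]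
    rw [← this, Matrix.sub_mulVec, Matrix.one_mulVec]
    abel
  have hv : ∀ k : V → ℝ, P.kindnessInput G k = ∑ m, k m • v m := fun k => by
    ext d
    simp [v, kindnessInput, Finset.sum_apply, Pi.single_apply, mul_comm]
  have hv0 : ∀ m d, 0 ≤ v m d := fun m d =>
    mul_nonneg (P.stubbornness_nonneg _) (by rw [Pi.single_apply]; split_ifs <;> norm_num)
  refine ⟨fun d m => z m d, ρ, hρ0, hρ1, fun k => ?_, fun d m hm => ?_, fun d m hm => ?_,
    fun d => ?_⟩
  · have hzk : (∑ m, k m • z m) = A.mulVec (∑ m, k m • z m) + P.kindnessInput G k := by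
      rw [hv, Matrix.mulVec_sum, ← Finset.sum_add_distrib]
      refine Finset.sum_congr rfl fun m _ => ?_
      rw [Matrix.mulVec_smul, ← smul_add, ← hz]
    refine ⟨C * ‖P.dartAction G k 0 - ∑ m, k m • z m‖, fun d t => ?_⟩
    have h₁ := hrate (P.dartAction G k 0 - ∑ m, k m • z m) t
    rw [← P.dartAction_sub_of_eq G hzk] at h₁
    have h₂ := (norm_le_pi_norm _ d).trans h₁
    rw [Real.norm_eq_abs, mul_right_comm] at h₂
    simpa [Finset.sum_apply, mul_comm] using h₂
  -- Positivity: `A ^ t z` decreases to 0, so all its terms are nonnegative, and the drop at time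
  -- `N` is `A ^ N v`, which is strictly positive.
  · have hstep : ∀ t, (A ^ t).mulVec (z m) = (A ^ (t + 1)).mulVec (z m) + (A ^ t).mulVec (v m) :=
      fun t => by
        rw [pow_succ, ← Matrix.mulVec_mulVec, ← Matrix.mulVec_add, ← hz]
    have hanti : Antitone fun t => (A ^ t).mulVec (z m) d := antitone_nat_of_succ_le fun t => by
      rw [hstep t, Pi.add_apply]
      exact le_add_of_nonneg_right (Matrix.mulVec_nonneg_of_nonneg
        (Matrix.pow_entry_nonneg (P.transition_nonneg G) t) (hv0 m) d)
    have hnonneg : 0 ≤ (A ^ (N + 1)).mulVec (z m) d :=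
      hanti.le_of_tendsto ((tendsto_pi_nhds.1 (hlim (z m))) d) (N + 1)
    have hpos : 0 < (A ^ N).mulVec (v m) d := by
      obtain ⟨e, rfl⟩ := hdart m
      refine Finset.sum_pos' (fun f _ => mul_nonneg (hN d f).le (hv0 _ f))
        ⟨e, Finset.mem_univ e, mul_pos (hN d e) ?_⟩
      simpa [v, kindnessInput] using P.stubbornness_pos hm
    have hle : (A ^ N).mulVec (z m) d ≤ z m d := by simpa using hanti (Nat.zero_le N)
    have := congrFun (hstep N) d
    rw [Pi.add_apply] at this
    linarith
  · have : v m = 0 := by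
      ext e
      simp only [v, kindnessInput, Pi.single_apply, Pi.zero_apply]
      split_ifs with he
      · rw [he, P.stubbornness_eq_zero hm, zero_mul]
      · rw [mul_zero]
    simp [z, this]
  · have h₁ : ∑ m, v m = (1 - A).mulVec 1 := by
      rw [Matrix.sub_mulVec, Matrix.one_mulVec, hA, transition_mulVec_one, hv]
      simp
    have h₂ : ∑ m, z m = 1 := by
      simp only [z]
      rw [← Matrix.mulVec_sum, h₁, Matrix.mulVec_mulVec, Matrix.nonsing_inv_mul _ hdet,
        Matrix.one_mulVec]
    simpa using congrFun h₂ d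

/-- The actions converge geometrically to weighted means of the kindness values; the weights are
carried by the fixed agents if there are any, and are explicit otherwise. -/
theorem exists_limit_coefficients [Nontrivial V] (hG : G.Connected) (hr' : ∀ i, 0 < P.r' i)
    (h : (∃ (v : V) (c : G.Walk v v), c.IsCycle ∧ Odd c.length) ∨
      (∃ i, P.IsFloating i ∧ P.r i + P.r' i < 1)) :
    ∃ (c : G.Dart → V → ℝ) (ρ : ℝ), 0 < ρ ∧ ρ < 1 ∧
      (∀ k : V → ℝ, ∃ C : ℝ, ∀ d t, |P.dartAction G k t d - ∑ m, c d m * k m| ≤ C * ρ ^ t) ∧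
      (∀ d, ∑ m, c d m = 1) ∧
      ((∃ m, P.IsFixed m) → ∀ d,
        (∀ m, P.IsFixed m → 0 < c d m) ∧ (∀ m, P.IsFloating m → c d m = 0)) ∧
      ((∀ m, P.IsFloating m) → ∀ d m, 0 < c d m ∧
        c d m = (G.degree m : ℝ) / (P.r m + P.r' m) /
          ∑ m, (G.degree m : ℝ) / (P.r m + P.r' m)) := by
  by_cases hfix : ∃ m, P.IsFixed m
  · obtain ⟨c, ρ, hρ0, hρ1, hrate, hpos, hzero, hsum⟩ :=
      P.exists_rate_of_exists_isFixed G hG hr' h hfix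
    obtain ⟨m, hm⟩ := hfix
    exact ⟨c, ρ, hρ0, hρ1, hrate, hsum, fun _ d => ⟨hpos d, hzero d⟩,
      fun hfl => absurd hm ((P.not_isFixed_iff m).2 (hfl m))⟩
  · have hfl : ∀ m, P.IsFloating m := fun m =>
      (P.not_isFixed_iff m).1 fun hm => hfix ⟨m, hm⟩
    obtain ⟨ρ, hρ0, hρ1, hrate⟩ := P.exists_rate_of_forall_isFloating G hG hr' h hfl
    have hw : ∀ m, 0 < (G.degree m : ℝ) / (P.r m + P.r' m) := fun m =>
      div_pos (by exact_mod_cast hG.preconnected.degree_pos_of_nontrivial m)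
        (add_pos_of_nonneg_of_pos (P.r_mem m).1 (hr' m))
    have hW : 0 < ∑ m, (G.degree m : ℝ) / (P.r m + P.r' m) :=
      Finset.sum_pos (fun m _ => hw m) Finset.univ_nonempty
    refine ⟨fun _ m => (G.degree m : ℝ) / (P.r m + P.r' m) /
      ∑ m, (G.degree m : ℝ) / (P.r m + P.r' m), ρ, hρ0, hρ1, fun k => ?_, fun d => ?_,
      fun h => absurd h hfix, fun _ d m => ⟨div_pos (hw m) hW, rfl⟩⟩
    · obtain ⟨C, hC⟩ := hrate k
      refine ⟨C, fun d t => ?_⟩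
      have := hC d t
      rw [Finset.sum_div] at this
      simpa only [div_mul_eq_mul_div] using this
    · rw [← Finset.sum_div, div_self hW.ne']

end ReciprocalAgents

/-! ### The theorem for pairs of adjacent agents -/

theorem mainTheorem1 {V : Type*} [Fintype V] [Nontrivial V]
    (G : SimpleGraph V) [DecidableRel G.Adj] (hG : G.Connected)
    (P : ReciprocalAgents V) (hr' : ∀ i, 0 < P.r' i)
    (h : (∃ (v : V) (c : G.Walk v v), c.IsCycle ∧ Odd c.length) ∨
      (∃ i, P.IsFloating i ∧ P.r i + P.r' i < 1)) :
    -- the limits `L k i j`, as a function of the kindness vector `k`,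
    -- the coefficients `c i j m`, independent of the kindness, and the geometric rate `ρ`
    ∃ (L : (V → ℝ) → V → V → ℝ) (c : V → V → V → ℝ) (ρ : ℝ),
      -- every action converges, geometrically fast
      (∀ (k : V → ℝ) (i j : V), G.Adj i j →
        Tendsto (fun t => P.action G k t i j) atTop (𝓝 (L k i j))) ∧
      (0 < ρ ∧ ρ < 1 ∧
        ∀ k : V → ℝ, ∃ C : ℝ, ∀ (i j : V), G.Adj i j → ∀ t : ℕ,
          |P.action G k t i j - L k i j| ≤ C * ρ ^ t) ∧
      -- the limits are positive combinations of the kindness values of the relevant agents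
      (∀ (k : V → ℝ) (i j : V), G.Adj i j → L k i j = ∑ m, c i j m * k m) ∧
      ((∃ m, P.IsFixed m) → ∀ i j, G.Adj i j →
        (∀ m, P.IsFixed m → 0 < c i j m) ∧ (∀ m, P.IsFloating m → c i j m = 0)) ∧
      ((∀ m, P.IsFloating m) → ∀ i j, G.Adj i j →
        (∀ m, 0 < c i j m) ∧ ∑ m, c i j m = 1) ∧
      -- all agents floating: the common limit
      ((∀ m, P.IsFloating m) → ∀ (k : V → ℝ) (i j : V), G.Adj i j →
        L k i j = (∑ m, (G.degree m : ℝ) / (P.r m + P.r' m) * k m) /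
          (∑ m, (G.degree m : ℝ) / (P.r m + P.r' m))) ∧
      -- at least one fixed agent, and all fixed agents have the same kindness `κ`
      ((∃ m, P.IsFixed m) → ∀ (k : V → ℝ) (κ : ℝ), (∀ m, P.IsFixed m → k m = κ) →
        ∀ i j, G.Adj i j → L k i j = κ) ∧
      -- at least one fixed agent: the kindness of the floating agents does not matter
      ((∃ m, P.IsFixed m) → ∀ k₁ k₂ : V → ℝ, (∀ m, P.IsFixed m → k₁ m = k₂ m) →
        ∀ i j, G.Adj i j → L k₁ i j = L k₂ i j) := by
  classical
  obtain ⟨c, ρ, hρ0, hρ1, hrate, hsum, hfix, hfl⟩ := P.exists_limit_coefficients G hG hr' h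
  have hzero : (∃ m, P.IsFixed m) → ∀ d m, ¬ P.IsFixed m → c d m = 0 := fun hex d m hm =>
    (hfix hex d).2 m ((P.not_isFixed_iff m).1 hm)
  have hcongr : (∃ m, P.IsFixed m) → ∀ (k₁ k₂ : V → ℝ), (∀ m, P.IsFixed m → k₁ m = k₂ m) →
      ∀ d, ∑ m, c d m * k₁ m = ∑ m, c d m * k₂ m := fun hex k₁ k₂ hk d =>
    Finset.sum_congr rfl fun m _ => by
      by_cases hm : P.IsFixed m
      · rw [hk m hm]
      · rw [hzero hex d m hm, zero_mul, zero_mul]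
  let c' : V → V → V → ℝ := fun i j m => if hij : G.Adj i j then c ⟨(i, j), hij⟩ m else 0
  have hc' : ∀ {i j} (hij : G.Adj i j), c' i j = c ⟨(i, j), hij⟩ := fun hij => by
    ext m; simp only [c', dif_pos hij]
  have hbound : ∀ k : V → ℝ, ∃ C : ℝ, ∀ (i j : V), G.Adj i j → ∀ t : ℕ,
      |P.action G k t i j - ∑ m, c' i j m * k m| ≤ C * ρ ^ t := fun k => by
    obtain ⟨C, hC⟩ := hrate k
    refine ⟨C, fun i j hij t => ?_⟩
    rw [hc' hij]
    exact hC ⟨(i, j), hij⟩ t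
  refine ⟨fun k i j => ∑ m, c' i j m * k m, c', ρ, fun k i j hij => ?_, ⟨hρ0, hρ1, hbound⟩,
    fun k i j _ => rfl, fun hex i j hij => ?_, fun hall i j hij => ?_, fun hall k i j hij => ?_,
    fun hex k κ hκ i j hij => ?_, fun hex k₁ k₂ hk i j hij => ?_⟩
  · obtain ⟨C, hC⟩ := hbound k
    refine tendsto_iff_norm_sub_tendsto_zero.2 (squeeze_zero (fun t => norm_nonneg _)
      (hC i j hij) ?_)
    simpa using (tendsto_pow_atTop_nhds_zero_of_lt_one hρ0.le hρ1).const_mul C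
  · rw [hc' hij]
    exact hfix hex _
  · rw [hc' hij]
    exact ⟨fun m => (hfl hall _ m).1, hsum _⟩
  · simp only [hc' hij]
    rw [Finset.sum_div]
    refine Finset.sum_congr rfl fun m _ => ?_
    rw [(hfl hall _ m).2, div_mul_eq_mul_div]
  · simp only [hc' hij]
    -- Replace `k` by the constant vector `κ`, which agrees with it on the fixed agents.
    rw [hcongr hex k (fun _ => κ) hκ, ← Finset.sum_mul, hsum, one_mul]
  · simp only [hc' hij]
    exact hcongr hex k₁ k₂ hk _
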